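/- Let $m,k\ge 1$, $n\ge k$ and $r\ge k$ be integers, and let $A=(A_1\;\,A_2)\in\mathbb{R}^{m\times n}$ with $A_1\in\mathbb{R}^{m\times k}$ of full column rank $k$ and $A_2\in\mathbb{R}^{m\times(n-k)}$. Let $P_{A_1}$ and $P_{A_1}^{\perp}$ be the orthogonal projections of $\mathbb{R}^m$ onto the column space of $A_1$ and onto its orthogonal complement, acting on matrices column by column. Let $\sigma_1\ge\sigma_2\ge\cdots\ge 0$ be the singular values of $P_{A_1}^{\perp}(A_2)$, with multiplicity, continued by zeros, and put $\sigma_0:=\infty$. For a matrix $B$ with a singular value decomposition $B=U\Sigma V^T$ (singular values in non-increasing order on the diagonal of $\Sigma$) let $H_p(B)=U\Sigma_pV^T$, where $\Sigma_p$ arises from $\Sigma$ by keeping the $p$ largest singular values and replacing the others by $0$. Suppose that $\sigma_{r-k}>\sigma_{r-k+1}$. Then: (a) The problem of minimizing $\|(A_1\;\,A_2)-(X_1\;\,X_2)\|_F^2$ over all $X_1\in\mathbb{R}^{m\times k}$, $X_2\in\mathbb{R}^{m\times(n-k)}$ with $X_1=A_1$ and $\operatorname{rank}(X_1\;\,X_2)\le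 r$ has exactly one solution $A_G=(A_1\;\,\tilde A_2)$. The matrix $H_{r-k}(P_{A_1}^{\perp}(A_2))$ does not depend on the choice of the singular value decomposition, and $\tilde A_2=P_{A_1}(A_2)+H_{r-k}\bigl(P_{A_1}^{\perp}(A_2)\bigr)$. (b) For a weight matrix $W_1\in\mathbb{R}^{m\times k}$ put $\lambda=\min_{i,j}(W_1)_{ij}$, and let $\mathbb{1}$ be the $m\times(n-k)$ matrix of ones. There are constants $C$ and $\Lambda>0$, depending only on $A_1$, $A_2$ and $r$, such that for every $W_1$ with $\lambda\ge\Lambda$, every minimizer $(\tilde X_1(W)\;\,\tilde X_2(W))$ of $\|((A_1\;\,A_2)-(X_1\;\,X_2))\odot(W_1\;\,\mathbb{1})\|_F^2$ over all $(X_1\;\,X_2)$ with $\operatorname{rank}(X_1\;\,X_2)\le r$ (where $\odot$ is the entrywise product) satisfies $$\bigl\|(\tilde X_1(W)\;\,\tilde X_2(W))-A_G\bigr\|_F\le\frac{C}{\lambda}.$$ That is, $(\tilde X_1(W)\;\,\tilde X_2(W))=A_G+O(1/\lambda)$ as $\lambda\to\infty$. -/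

import Mathlib

open scoped Matrix Matrix.Norms.Frobenius

noncomputable section

namespace WLRA

/-- The smallest entry of a weight matrix: the minimum over the columns `j` of the minimum over
the rows `i` of `W i j` (both index sets are nonempty wherever this is used). -/
def minWeight {m k : ℕ} (W : Matrix (Fin m) (Fin k) ℝ) : ℝ := ⨅ j, ⨅ i, W i j

/-- `(X₁ X₂)` solves the weighted low rank approximation problem: it minimizes the squared
Frobenius norm of `((A₁ A₂) - (Y₁ Y₂)) ⊙ (W₁ W₂)` among all `(Y₁ Y₂)` of rank at most `r`. -/
def IsWeightedSolution {m k l : ℕ} (A₁ : Matrix (Fin m) (Fin k) ℝ) (A₂ : Matrix (Fin m) (Fin l) ℝ)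
    (W₁ : Matrix (Fin m) (Fin k) ℝ) (W₂ : Matrix (Fin m) (Fin l) ℝ) (r : ℕ)
    (X₁ : Matrix (Fin m) (Fin k) ℝ) (X₂ : Matrix (Fin m) (Fin l) ℝ) : Prop :=
  (Matrix.fromCols X₁ X₂).rank ≤ r ∧
    ∀ (Y₁ : Matrix (Fin m) (Fin k) ℝ) (Y₂ : Matrix (Fin m) (Fin l) ℝ),
      (Matrix.fromCols Y₁ Y₂).rank ≤ r →
        ‖(Matrix.fromCols A₁ A₂ - Matrix.fromCols X₁ X₂) ⊙ Matrix.fromCols W₁ W₂‖ ^ 2 ≤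
          ‖(Matrix.fromCols A₁ A₂ - Matrix.fromCols Y₁ Y₂) ⊙ Matrix.fromCols W₁ W₂‖ ^ 2

/-- `(X₁ X₂)` solves the constrained low rank approximation problem of Golub, Hoffman and Stewart:
it minimizes the squared Frobenius distance to `(A₁ A₂)` among all `(Y₁ Y₂)` of rank at most `r`
with `Y₁ = A₁`. -/
def IsConstrainedSolution {m k l : ℕ} (A₁ : Matrix (Fin m) (Fin k) ℝ)
    (A₂ : Matrix (Fin m) (Fin l) ℝ) (r : ℕ)
    (X₁ : Matrix (Fin m) (Fin k) ℝ) (X₂ : Matrix (Fin m) (Fin l) ℝ) : Prop :=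
  X₁ = A₁ ∧ (Matrix.fromCols X₁ X₂).rank ≤ r ∧
    ∀ (Y₁ : Matrix (Fin m) (Fin k) ℝ) (Y₂ : Matrix (Fin m) (Fin l) ℝ),
      Y₁ = A₁ → (Matrix.fromCols Y₁ Y₂).rank ≤ r →
        ‖Matrix.fromCols A₁ A₂ - Matrix.fromCols X₁ X₂‖ ^ 2 ≤
          ‖Matrix.fromCols A₁ A₂ - Matrix.fromCols Y₁ Y₂‖ ^ 2

/-- The column space of a matrix, in Euclidean space. -/
def colSpace {m n : ℕ} (B : Matrix (Fin m) (Fin n) ℝ) : Submodule ℝ (EuclideanSpace ℝ (Fin m)) :=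
  LinearMap.range (Matrix.toEuclideanLin B)

/-- `P_B(C)`: every column of `C` is projected orthogonally onto the column space of `B`. -/
def proj {m n l : ℕ} (B : Matrix (Fin m) (Fin n) ℝ) (C : Matrix (Fin m) (Fin l) ℝ) :
    Matrix (Fin m) (Fin l) ℝ :=
  Matrix.of fun i j => (colSpace B).starProjection (WithLp.toLp 2 (fun i' => C i' j)) i

/-- `P_B^⊥(C)`: every column of `C` is projected orthogonally onto the orthogonal complement of
the column space of `B`. -/
def projPerp {m n l : ℕ} (B : Matrix (Fin m) (Fin n) ℝ) (C : Matrix (Fin m) (Fin l) ℝ) :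
    Matrix (Fin m) (Fin l) ℝ :=
  Matrix.of fun i j => (colSpace B)ᗮ.starProjection (WithLp.toLp 2 (fun i' => C i' j)) i

/-- The singular values of a matrix in non-increasing order, with multiplicity, continued by `0`.
The numbering starts at `0`: `sv B i` is the `(i + 1)`-st singular value. -/
def sv {m n : ℕ} (B : Matrix (Fin m) (Fin n) ℝ) (i : ℕ) : ℝ :=
  (Matrix.toEuclideanLin B).singularValues i

/-- The rectangular diagonal matrix with diagonal `d 0, d 1, …`. -/
def rectDiag (m n : ℕ) (d : ℕ → ℝ) : Matrix (Fin m) (Fin n) ℝ :=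
  Matrix.of fun i j => if (i : ℕ) = (j : ℕ) then d i else 0

/-- `H` is a value of the hard thresholding `H_p(B)`: for some singular value decomposition
`B = U Σ Vᵀ`, one has `H = U Σ_p Vᵀ`, where `Σ_p` keeps the `p` largest singular values on the
diagonal of `Σ` and replaces the others by `0`. -/
def IsHardThresholding {m n : ℕ} (p : ℕ) (B H : Matrix (Fin m) (Fin n) ℝ) : Prop :=
  ∃ U ∈ Matrix.orthogonalGroup (Fin m) ℝ, ∃ V ∈ Matrix.orthogonalGroup (Fin n) ℝ,
    B = U * rectDiag m n (sv B) * Vᵀ ∧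
      H = U * rectDiag m n (fun i => if i < p then sv B i else 0) * Vᵀ

end WLRA

end

open scoped Matrix Matrix.Norms.Frobenius

noncomputable section

namespace WLRA

open Matrix

/-! ### The Frobenius norm and its inner product -/

/-! The engine is quadratic growth (`exists_quadratic_growth`): a gap after the `p`-th singular
value of `B` gives `‖B - H₀‖² + c‖H - H₀‖² ≤ ‖B - H‖²` whenever `rank H ≤ p`, where `H₀` is the hard
thresholding. This is Eckart–Young for the matrix whose discarded singular values are enlarged
without overtaking the kept ones: `H₀` stays optimal there, which leaves slack for `B`.

By `rank_fromCols` and Pythagoras, the constrained problem reduces to approximating `P^⊥ A₂` in rank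
`r - k` and inherits the growth. This gives (a).

For (b), comparison with `A_G` forces `X₁ - A₁ = O(1/λ)`. Full column rank gives `X₁ = (1 + E) A₁`
with `E = O(1/λ)` and `1 + E` invertible, so multiplication by `1 + E` exchanges competitors with
first block `A₁` and those with first block `X₁`. With `Y = (1 + E)⁻¹ X₂`, growth and optimality
yield `c‖Y - A'‖² = O(‖E‖ ‖Y - A'‖)` (`norm_sub_le_of_quadratic_growth`); a bound `O(‖E‖)` alone
would only give the rate `λ^(-1/2)`. -/

/-- The squared Frobenius norm as a trace. -/
lemma frobenius_norm_sq {ι κ : Type*} [Fintype ι] [Fintype κ] (A : Matrix ι κ ℝ) :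
    ‖A‖ ^ 2 = trace (Aᵀ * A) := by
  rw [frobenius_norm_def, ← Real.sqrt_eq_rpow, Real.sq_sqrt (by positivity)]
  simp only [trace, diag, mul_apply, transpose_apply]
  rw [Finset.sum_comm]
  simp [pow_two]

lemma frobenius_norm_sq_eq_sum {ι κ : Type*} [Fintype ι] [Fintype κ] (A : Matrix ι κ ℝ) :
    ‖A‖ ^ 2 = ∑ i, ∑ j, A i j ^ 2 := by
  rw [frobenius_norm_def, ← Real.sqrt_eq_rpow, Real.sq_sqrt (by positivity)]
  simp

lemma frobenius_norm_add_sq {ι κ : Type*} [Fintype ι] [Fintype κ] (A B : Matrix ι κ ℝ) :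
    ‖A + B‖ ^ 2 = ‖A‖ ^ 2 + 2 * trace (Aᵀ * B) + ‖B‖ ^ 2 := by
  have h : trace (Bᵀ * A) = trace (Aᵀ * B) := by
    rw [← trace_transpose (Aᵀ * B), transpose_mul, transpose_transpose]
  simp only [frobenius_norm_sq, transpose_add, Matrix.add_mul, Matrix.mul_add, trace_add, h]
  ring

lemma frobenius_norm_sub_sq {ι κ : Type*} [Fintype ι] [Fintype κ] (A B : Matrix ι κ ℝ) :
    ‖A - B‖ ^ 2 = ‖A‖ ^ 2 - 2 * trace (Aᵀ * B) + ‖B‖ ^ 2 := by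
  rw [sub_eq_add_neg, frobenius_norm_add_sq, norm_neg, Matrix.mul_neg, trace_neg]
  ring

/-- The Cauchy–Schwarz inequality for the Frobenius inner product. -/
lemma abs_trace_transpose_mul_le {ι κ : Type*} [Fintype ι] [Fintype κ] (A B : Matrix ι κ ℝ) :
    |trace (Aᵀ * B)| ≤ ‖A‖ * ‖B‖ := by
  apply abs_le_of_sq_le_sq _ (by positivity)
  rw [mul_pow, frobenius_norm_sq_eq_sum, frobenius_norm_sq_eq_sum]
  have h : trace (Aᵀ * B) = ∑ x : ι × κ, A x.1 x.2 * B x.1 x.2 := by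
    rw [Fintype.sum_prod_type, Finset.sum_comm]
    simp [trace, mul_apply]
  rw [h, ← Fintype.sum_prod_type (f := fun x : ι × κ => A x.1 x.2 ^ 2),
    ← Fintype.sum_prod_type (f := fun x : ι × κ => B x.1 x.2 ^ 2)]
  exact Finset.sum_mul_sq_le_sq_mul_sq _ _ _

lemma frobenius_norm_fromCols_sq {ι κ κ' : Type*} [Fintype ι] [Fintype κ] [Fintype κ']
    (A : Matrix ι κ ℝ) (B : Matrix ι κ' ℝ) : ‖fromCols A B‖ ^ 2 = ‖A‖ ^ 2 + ‖B‖ ^ 2 := by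
  simp [frobenius_norm_sq_eq_sum, Finset.sum_add_distrib]

lemma frobenius_norm_orthogonal_mul {m n : ℕ} {U : Matrix (Fin m) (Fin m) ℝ}
    (hU : U ∈ orthogonalGroup (Fin m) ℝ) (A : Matrix (Fin m) (Fin n) ℝ) : ‖U * A‖ = ‖A‖ := by
  rw [← sq_eq_sq₀ (norm_nonneg _) (norm_nonneg _), frobenius_norm_sq, frobenius_norm_sq,
    transpose_mul, Matrix.mul_assoc, ← Matrix.mul_assoc Uᵀ U A]
  have h : Uᵀ * U = 1 := (mem_orthogonalGroup_iff' (Fin m) ℝ).1 hU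
  rw [h, Matrix.one_mul]

lemma frobenius_norm_mul_transpose_orthogonal {m n : ℕ} {V : Matrix (Fin n) (Fin n) ℝ}
    (hV : V ∈ orthogonalGroup (Fin n) ℝ) (A : Matrix (Fin m) (Fin n) ℝ) : ‖A * Vᵀ‖ = ‖A‖ := by
  rw [← frobenius_norm_transpose, transpose_mul, transpose_transpose,
    frobenius_norm_orthogonal_mul hV, frobenius_norm_transpose]

/-! ### Projections onto column spaces as matrices -/

lemma fromCols_sub_fromCols {ι κ κ' : Type*} (A B : Matrix ι κ ℝ) (C D : Matrix ι κ' ℝ) :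
    fromCols A C - fromCols B D = fromCols (A - B) (C - D) := by
  ext i (j | j) <;> rfl

/-- The matrix of the orthogonal projection onto the column space of `B`. -/
def projMat {m n : ℕ} (B : Matrix (Fin m) (Fin n) ℝ) : Matrix (Fin m) (Fin m) ℝ :=
  toEuclideanLin.symm ((colSpace B).starProjection : _ →ₗ[ℝ] _)

lemma toEuclideanLin_projMat {m n : ℕ} (B : Matrix (Fin m) (Fin n) ℝ) :
    toEuclideanLin (projMat B) = ((colSpace B).starProjection : _ →ₗ[ℝ] _) := by
  simp [projMat]

lemma projMat_mulVec {m n : ℕ} (B : Matrix (Fin m) (Fin n) ℝ) (v : Fin m → ℝ) :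
    projMat B *ᵥ v = ((colSpace B).starProjection (WithLp.toLp 2 v)).ofLp := by
  have h := congrArg (fun f => (f (WithLp.toLp 2 v)).ofLp) (toEuclideanLin_projMat B)
  simpa using h

lemma proj_eq_mul {m n l : ℕ} (B : Matrix (Fin m) (Fin n) ℝ) (C : Matrix (Fin m) (Fin l) ℝ) :
    proj B C = projMat B * C := by
  ext i j
  exact (congrFun (projMat_mulVec B (fun i' => C i' j)) i).symm

lemma projPerp_eq_mul {m n l : ℕ} (B : Matrix (Fin m) (Fin n) ℝ) (C : Matrix (Fin m) (Fin l) ℝ) :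
    projPerp B C = (1 - projMat B) * C := by
  rw [Matrix.sub_mul, Matrix.one_mul, ← proj_eq_mul]
  ext i j
  simp [projPerp, proj, Submodule.starProjection_orthogonal_val]

lemma projMat_mul_self {m n : ℕ} (B : Matrix (Fin m) (Fin n) ℝ) : projMat B * B = B := by
  rw [← proj_eq_mul]
  ext i j
  have h : WithLp.toLp 2 (fun i' => B i' j) ∈ colSpace B :=
    ⟨WithLp.toLp 2 (Pi.single j 1), by ext i; simp⟩
  simp [proj, Submodule.starProjection_eq_self_iff.2 h]

lemma projMat_transpose {m n : ℕ} (B : Matrix (Fin m) (Fin n) ℝ) :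
    (projMat B)ᵀ = projMat B := by
  have h : (toEuclideanLin (projMat B)).IsSymmetric := by
    rw [toEuclideanLin_projMat]
    exact (colSpace B).starProjection_isSymmetric
  simpa [IsHermitian] using isSymmetric_toEuclideanLin_iff.1 h

lemma exists_projMat_eq_mul {m n : ℕ} (B : Matrix (Fin m) (Fin n) ℝ) :
    ∃ Z : Matrix (Fin n) (Fin m) ℝ, projMat B = B * Z := by
  have h (j : Fin m) : ∃ z, toEuclideanLin B z =
      (colSpace B).starProjection (WithLp.toLp 2 (Pi.single j 1)) :=
    (colSpace B).starProjection_apply_mem _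
  choose z hz using h
  refine ⟨of fun i j => z j i, ?_⟩
  ext i j
  have h1 := congrFun (projMat_mulVec B (Pi.single j 1)) i
  rw [← hz] at h1
  rw [mulVec_single_one] at h1
  simpa [mul_apply, mulVec, dotProduct] using h1

lemma projMat_mul_projMat {m n : ℕ} (B : Matrix (Fin m) (Fin n) ℝ) :
    projMat B * projMat B = projMat B := by
  obtain ⟨Z, hZ⟩ := exists_projMat_eq_mul B
  nth_rewrite 2 [hZ]
  rw [← Matrix.mul_assoc, projMat_mul_self, hZ]

lemma rank_eq_finrank_colSpace {m n : ℕ} (B : Matrix (Fin m) (Fin n) ℝ) :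
    B.rank = Module.finrank ℝ (colSpace B) := by
  rw [colSpace, toEuclideanLin_eq_toLin_orthonormal]
  exact B.rank_eq_finrank_range_toLin _ _

lemma trace_projMat {m n : ℕ} (B : Matrix (Fin m) (Fin n) ℝ) :
    trace (projMat B) = B.rank := by
  have h : LinearMap.IsProj (colSpace B) (toEuclideanLin (projMat B)) := by
    rw [toEuclideanLin_projMat]
    exact ⟨fun x => Submodule.starProjection_apply_mem _ x,
      fun x hx => Submodule.starProjection_eq_self_iff.2 hx⟩
  rw [rank_eq_finrank_colSpace, ← h.trace, toEuclideanLin_eq_toLin_orthonormal,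
    trace_toLin_eq]

/-! ### Singular value decompositions -/

/-- The matrix whose columns are the vectors of an orthonormal basis is orthogonal. -/
lemma of_orthonormalBasis_mem_orthogonalGroup {n : ℕ}
    (b : OrthonormalBasis (Fin n) ℝ (EuclideanSpace ℝ (Fin n))) :
    (of fun i j => b j i) ∈ orthogonalGroup (Fin n) ℝ := by
  rw [mem_orthogonalGroup_iff']
  ext i j
  have h := orthonormal_iff_ite.1 b.orthonormal i j
  rw [PiLp.inner_apply] at h
  simpa [mul_apply, one_apply, mul_comm] using h

lemma sv_nonneg {m n : ℕ} (B : Matrix (Fin m) (Fin n) ℝ) (i : ℕ) : 0 ≤ sv B i :=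
  LinearMap.singularValues_nonneg _ i

lemma sv_antitone {m n : ℕ} (B : Matrix (Fin m) (Fin n) ℝ) : Antitone (sv B) :=
  LinearMap.singularValues_antitone _

lemma sv_eq_zero_of_width_le {m n : ℕ} (B : Matrix (Fin m) (Fin n) ℝ) {i : ℕ} (hi : n ≤ i) :
    sv B i = 0 :=
  LinearMap.singularValues_of_finrank_le _ (by simpa using hi)

lemma sv_eq_zero_of_height_le {m n : ℕ} (B : Matrix (Fin m) (Fin n) ℝ) {i : ℕ} (hi : m ≤ i) :
    sv B i = 0 := by
  apply (LinearMap.singularValues_eq_zero_iff_le_finrank_range _).2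
  exact ((Submodule.finrank_le _).trans (by simp)).trans hi

/-- Every real matrix has a singular value decomposition. -/
theorem exists_svd {m n : ℕ} (B : Matrix (Fin m) (Fin n) ℝ) :
    ∃ U ∈ orthogonalGroup (Fin m) ℝ, ∃ V ∈ orthogonalGroup (Fin n) ℝ,
      B = U * rectDiag m n (sv B) * Vᵀ := by
  set T := toEuclideanLin B with hT
  have hn : Module.finrank ℝ (EuclideanSpace ℝ (Fin n)) = n := by simp
  set v := T.isSymmetric_adjoint_comp_self.eigenvectorBasis hn with hv
  have hinner (i j : Fin n) : inner ℝ (T (v i)) (T (v j)) = if i = j then sv B i ^ 2 else 0 := by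
    rw [← LinearMap.adjoint_inner_right, ← LinearMap.comp_apply, hv,
      LinearMap.IsSymmetric.apply_eigenvectorBasis, inner_smul_right, ← hv,
      orthonormal_iff_ite.1 v.orthonormal i j, ← LinearMap.sq_singularValues_fin]
    split_ifs with h
    · subst h; simp [sv, hT]
    · simp
  have hzero (j : Fin n) (hj : sv B j = 0) : T (v j) = 0 := by
    rw [← inner_self_eq_zero (𝕜 := ℝ), hinner, if_pos rfl, hj]; simp
  -- Left singular vectors `T vᵢ / σᵢ`, meaningful only where `σᵢ ≠ 0`; the zeros elsewhere are
  -- placeholders, replaced when the family is extended to an orthonormal basis.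
  set w : Fin m → EuclideanSpace ℝ (Fin m) := fun i =>
    if h : (i : ℕ) < n then (sv B i)⁻¹ • T (v ⟨i, h⟩) else 0 with hw
  have hlt {i : ℕ} (hi : sv B i ≠ 0) : i < n := by
    by_contra h
    exact hi (sv_eq_zero_of_width_le B (not_lt.1 h))
  have hon : Orthonormal ℝ (({i : Fin m | sv B i ≠ 0} : Set (Fin m)).domRestrict w) := by
    rw [orthonormal_iff_ite]
    rintro ⟨i, hi⟩ ⟨j, hj⟩
    have hi' : sv B i ≠ 0 := hi
    have hj' : sv B j ≠ 0 := hj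
    simp only [Set.domRestrict_apply, hw, hlt hi', hlt hj', dif_pos, inner_smul_left,
      inner_smul_right, hinner, Subtype.mk.injEq, Fin.ext_iff]
    split_ifs with h
    · rw [← h]; simp; field_simp
    · simp
  obtain ⟨b, hb⟩ := hon.exists_orthonormalBasis_extension_of_card_eq (by simp)
  set U : Matrix (Fin m) (Fin m) ℝ := of fun i j => b j i with hU
  set V : Matrix (Fin n) (Fin n) ℝ := of fun i j => v j i with hV
  have hVo : V ∈ orthogonalGroup (Fin n) ℝ := of_orthonormalBasis_mem_orthogonalGroup v
  refine ⟨U, of_orthonormalBasis_mem_orthogonalGroup b, V, hVo, ?_⟩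
  have hcol : B * V = U * rectDiag m n (sv B) := by
    ext i j
    have h1 : (B * V) i j = T (v j) i := by simp [hT, hV, mul_apply, mulVec, dotProduct]
    rw [h1, mul_apply]
    by_cases hj : (j : ℕ) < m
    · rw [Finset.sum_eq_single ⟨j, hj⟩ (fun x _ hx => by
          simp only [rectDiag, of_apply]
          rw [if_neg (fun h => hx (Fin.ext h)), mul_zero]) (by simp)]
      by_cases h0 : sv B j = 0
      · simp [hzero j h0, rectDiag, h0]
      · have h2 := hb ⟨j, hj⟩ h0
        simp [hU, h2, hw, rectDiag]
        field_simp
    · have h0 := sv_eq_zero_of_height_le B (not_lt.1 hj)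
      rw [hzero j h0]
      refine (Finset.sum_eq_zero fun x _ => ?_).symm
      simp only [rectDiag, of_apply]
      rw [if_neg (by have := x.2; omega), mul_zero]
  have hVV : V * Vᵀ = 1 := (mem_orthogonalGroup_iff (Fin n) ℝ).1 hVo
  rw [← hcol, Matrix.mul_assoc, hVV, Matrix.mul_one]

/-! ### The Eckart–Young theorem with quadratic growth -/

lemma frobenius_norm_rectDiag_sq (m n : ℕ) (d : ℕ → ℝ) :
    ‖rectDiag m n d‖ ^ 2 = ∑ i : Fin m, if (i : ℕ) < n then d i ^ 2 else 0 := by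
  rw [frobenius_norm_sq_eq_sum]
  refine Finset.sum_congr rfl fun i _ => ?_
  split_ifs with h
  · rw [Finset.sum_eq_single ⟨i, h⟩ (fun x _ hx => by
      simp only [rectDiag, of_apply]
      rw [if_neg (fun h => hx (Fin.ext h.symm))]; simp) (by simp)]
    simp [rectDiag]
  · refine Finset.sum_eq_zero fun x _ => ?_
    simp only [rectDiag, of_apply]
    rw [if_neg (by have := x.2; omega)]; simp

lemma rectDiag_mul_transpose (m n : ℕ) (d : ℕ → ℝ) :
    rectDiag m n d * (rectDiag m n d)ᵀ =
      diagonal fun i : Fin m => if (i : ℕ) < n then d i ^ 2 else 0 := by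
  ext i j
  simp only [mul_apply, transpose_apply, rectDiag, of_apply, diagonal_apply]
  by_cases h : (i : ℕ) < n
  · rw [Finset.sum_eq_single ⟨i, h⟩ (fun x _ hx => by
      rw [if_neg (fun h => hx (Fin.ext h.symm)), zero_mul]) (by simp)]
    by_cases hij : i = j
    · subst hij; simp [h, sq]
    · have : ¬ (j : ℕ) = i := fun h => hij (Fin.ext h.symm)
      simp [hij, this]
  · rw [Finset.sum_eq_zero fun x _ => by rw [if_neg (by have := x.2; omega), zero_mul]]
    simp [h]

lemma rectDiag_sub (m n : ℕ) (d e : ℕ → ℝ) :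
    rectDiag m n d - rectDiag m n e = rectDiag m n (fun i => d i - e i) := by
  ext i j
  by_cases h : (i : ℕ) = j <;> simp [rectDiag, h]

/-- Symmetry and idempotence make the residual affine in the projection; when `M * Mᵀ` is diagonal,
only the diagonal of `projMat H` matters. -/
lemma frobenius_norm_sub_projMat_mul_sq {m n l : ℕ} (H : Matrix (Fin m) (Fin n) ℝ)
    (M : Matrix (Fin m) (Fin l) ℝ) :
    ‖M - projMat H * M‖ ^ 2 = ‖M‖ ^ 2 - trace (M * Mᵀ * projMat H) := by
  have h : (projMat H * M)ᵀ * (projMat H * M) = Mᵀ * (projMat H * M) := by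
    rw [transpose_mul, projMat_transpose, Matrix.mul_assoc, ← Matrix.mul_assoc (projMat H),
      projMat_mul_projMat]
  have h' : trace (Mᵀ * (projMat H * M)) = trace (M * Mᵀ * projMat H) := by
    rw [← Matrix.mul_assoc, trace_mul_comm, Matrix.mul_assoc]
  rw [frobenius_norm_sub_sq, frobenius_norm_sq (projMat H * M), h, h']
  ring

/-- The columns of `projMat H * M` are the best approximations of those of `M` by the column space
of `H`. -/
lemma frobenius_norm_sub_projMat_mul_le {m n : ℕ} (H M : Matrix (Fin m) (Fin n) ℝ) :
    ‖M - projMat H * M‖ ^ 2 ≤ ‖M - H‖ ^ 2 := by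
  have h : M - H = (M - projMat H * M) + projMat H * (M - H) := by
    rw [Matrix.mul_sub, projMat_mul_self]; abel
  have h0 : (M - projMat H * M)ᵀ * (projMat H * (M - H)) = 0 := by
    rw [transpose_sub, transpose_mul, projMat_transpose, Matrix.sub_mul, Matrix.mul_assoc Mᵀ,
      ← Matrix.mul_assoc (projMat H), projMat_mul_projMat, sub_self]
  rw [h, frobenius_norm_add_sq, h0]
  simp only [trace_zero, mul_zero, add_zero]
  nlinarith [sq_nonneg ‖projMat H * (M - H)‖]

lemma projMat_diag_eq {m n : ℕ} (H : Matrix (Fin m) (Fin n) ℝ) (i : Fin m) :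
    projMat H i i = ∑ j, projMat H i j ^ 2 := by
  have h : projMat H * (projMat H)ᵀ = projMat H := by
    rw [projMat_transpose, projMat_mul_projMat]
  conv_lhs => rw [← h]
  simp [mul_apply, sq]

lemma projMat_diag_nonneg {m n : ℕ} (H : Matrix (Fin m) (Fin n) ℝ) (i : Fin m) :
    0 ≤ projMat H i i := by
  rw [projMat_diag_eq]; positivity

lemma projMat_diag_le_one {m n : ℕ} (H : Matrix (Fin m) (Fin n) ℝ) (i : Fin m) :
    projMat H i i ≤ 1 := by
  have h : projMat H i i ^ 2 ≤ ∑ j, projMat H i j ^ 2 :=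
    Finset.single_le_sum (f := fun j => projMat H i j ^ 2) (fun j _ => sq_nonneg _)
      (Finset.mem_univ i)
  rw [← projMat_diag_eq] at h
  nlinarith

/-- The Eckart–Young theorem for a rectangular diagonal matrix whose first `p` diagonal entries
are the largest. -/
lemma eckart_young_rectDiag {m n p : ℕ} (hp : p ≤ n) {d : ℕ → ℝ} {s : ℝ} (hs : 0 ≤ s)
    (hd : ∀ i, 0 ≤ d i) (hhi : ∀ i < p, s ≤ d i) (hlo : ∀ i, p ≤ i → d i ≤ s)
    {H : Matrix (Fin m) (Fin n) ℝ} (hH : H.rank ≤ p) :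
    ‖rectDiag m n d - rectDiag m n (fun i => if i < p then d i else 0)‖ ^ 2 ≤
      ‖rectDiag m n d - H‖ ^ 2 := by
  refine le_trans ?_ (frobenius_norm_sub_projMat_mul_le H _)
  rw [frobenius_norm_sub_projMat_mul_sq, rectDiag_mul_transpose, rectDiag_sub,
    frobenius_norm_rectDiag_sq, frobenius_norm_rectDiag_sq]
  simp only [trace, diag, diagonal_mul]
  rw [← Finset.sum_sub_distrib]
  have hcard : (H.rank : ℝ) ≤ ∑ i : Fin m, if (i : ℕ) < p then (1 : ℝ) else 0 := by
    have : H.rank ≤ m := H.rank_le_height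
    have h2 : H.rank ≤ min m p := le_min this hH
    have h3 : (Finset.univ.filter fun i : Fin m => (i : ℕ) < p).card = min m p := by
      rw [Fin.card_filter_val_lt]
    rw [Finset.sum_boole, h3]
    exact_mod_cast h2
  rw [← trace_projMat] at hcard
  simp only [trace, diag] at hcard
  -- Each `dᵢ²` may be replaced by `s²`: for `i < p` it multiplies `1 - Pᵢᵢ ≥ 0`, for `i ≥ p` it
  -- multiplies `-Pᵢᵢ ≤ 0`. What remains is nonnegative since `tr P = rank H ≤ min m p`.
  have key : s ^ 2 * (∑ i : Fin m, ((if (i : ℕ) < p then (1 : ℝ) else 0) - projMat H i i)) ≤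
      ∑ i : Fin m, (((if (i : ℕ) < n then d i ^ 2 else 0) -
        (if (i : ℕ) < n then d i ^ 2 else 0) * projMat H i i) -
        if (i : ℕ) < n then (d i - if (i : ℕ) < p then d i else 0) ^ 2 else 0) := by
    rw [Finset.mul_sum]
    refine Finset.sum_le_sum fun i _ => ?_
    have h0 := projMat_diag_nonneg H i
    have h1 := projMat_diag_le_one H i
    by_cases hip : (i : ℕ) < p
    · have hin : (i : ℕ) < n := hip.trans_le hp
      have := hhi i hip
      have : s ^ 2 ≤ d i ^ 2 := by gcongr
      simp only [hip, hin, if_true]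
      nlinarith
    · by_cases hin : (i : ℕ) < n
      · have h2 := hlo i (not_lt.1 hip)
        have : d i ^ 2 ≤ s ^ 2 := by have := hd i; gcongr
        simp only [hip, hin, if_true, if_false]
        nlinarith
      · simp only [hip, hin, if_false]
        nlinarith [mul_nonneg (sq_nonneg s) h0]
  rw [Finset.sum_sub_distrib, Finset.sum_sub_distrib] at key
  have : 0 ≤ s ^ 2 * (∑ i : Fin m, (if (i : ℕ) < p then (1 : ℝ) else 0) -
      ∑ i, projMat H i i) := mul_nonneg (sq_nonneg s) (sub_nonneg.2 hcard)
  linarith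

lemma eckart_young {m n p : ℕ} (hp : p ≤ n) {d : ℕ → ℝ} {s : ℝ} (hs : 0 ≤ s)
    (hd : ∀ i, 0 ≤ d i) (hhi : ∀ i < p, s ≤ d i) (hlo : ∀ i, p ≤ i → d i ≤ s)
    {U : Matrix (Fin m) (Fin m) ℝ} (hU : U ∈ orthogonalGroup (Fin m) ℝ)
    {V : Matrix (Fin n) (Fin n) ℝ} (hV : V ∈ orthogonalGroup (Fin n) ℝ)
    {H : Matrix (Fin m) (Fin n) ℝ} (hH : H.rank ≤ p) :
    ‖U * rectDiag m n d * Vᵀ - U * rectDiag m n (fun i => if i < p then d i else 0) * Vᵀ‖ ^ 2 ≤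
      ‖U * rectDiag m n d * Vᵀ - H‖ ^ 2 := by
  have hUU : U * Uᵀ = 1 := (mem_orthogonalGroup_iff (Fin m) ℝ).1 hU
  have hVV : V * Vᵀ = 1 := (mem_orthogonalGroup_iff (Fin n) ℝ).1 hV
  have hHe : H = U * (Uᵀ * H * V) * Vᵀ := by
    rw [Matrix.mul_assoc Uᵀ, ← Matrix.mul_assoc U, hUU, Matrix.one_mul, Matrix.mul_assoc, hVV,
      Matrix.mul_one]
  have hr : (Uᵀ * H * V).rank ≤ p :=
    ((rank_mul_le_left _ _).trans (rank_mul_le_right _ _)).trans hH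
  conv_rhs => rw [hHe]
  rw [← Matrix.sub_mul, ← Matrix.sub_mul, ← Matrix.mul_sub, ← Matrix.mul_sub,
    frobenius_norm_mul_transpose_orthogonal hV, frobenius_norm_mul_transpose_orthogonal hV,
    frobenius_norm_orthogonal_mul hU, frobenius_norm_orthogonal_mul hU]
  exact eckart_young_rectDiag hp hs hd hhi hlo hr

lemma exists_isHardThresholding {m n : ℕ} (p : ℕ) (B : Matrix (Fin m) (Fin n) ℝ) :
    ∃ H, IsHardThresholding p B H := by
  obtain ⟨U, hU, V, hV, h⟩ := exists_svd B
  exact ⟨_, U, hU, V, hV, h, rfl⟩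

lemma IsHardThresholding.rank_le {m n p : ℕ} {B H : Matrix (Fin m) (Fin n) ℝ}
    (h : IsHardThresholding p B H) : H.rank ≤ p := by
  obtain ⟨U, -, V, -, -, rfl⟩ := h
  refine ((rank_mul_le_left _ _).trans (rank_mul_le_right _ _)).trans ?_
  -- `D * Dᵀ` is a square diagonal matrix, so the rank counts its nonzero entries, all at indices
  -- below `p`.
  rw [← rank_self_mul_transpose, rectDiag_mul_transpose, rank_diagonal, Fintype.card_subtype]
  refine (Finset.card_le_card (t := Finset.univ.filter fun i : Fin m => (i : ℕ) < p) ?_).trans ?_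
  · intro i
    simp only [Finset.mem_filter, Finset.mem_univ, true_and]
    contrapose!
    intro hi
    simp [not_lt.2 hi]
  · rw [Fin.card_filter_val_lt]
    exact min_le_right _ _

/-- If there is a gap after the `p`-th singular value of `B`, then the squared distance to `B`
grows quadratically on the matrices of rank at most `p` away from the hard thresholding. -/
theorem exists_quadratic_growth {m n p : ℕ} (B : Matrix (Fin m) (Fin n) ℝ)
    (hgap : 0 < p → sv B p < sv B (p - 1)) :
    ∃ c : ℝ, 0 < c ∧ c ≤ 1 ∧ ∀ H₀, IsHardThresholding p B H₀ →
      ∀ H : Matrix (Fin m) (Fin n) ℝ, H.rank ≤ p →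
        ‖B - H₀‖ ^ 2 + c * ‖H - H₀‖ ^ 2 ≤ ‖B - H‖ ^ 2 := by
  -- The tail divided by `t` must stay below a bound `s` for the kept values. For `p = 0` nothing is
  -- kept and any `t` in `(0, 1)` works; otherwise `s` is the last kept value and `t` is the mean of
  -- the two values at the gap over `s`, positive even if `sv B p = 0`.
  obtain ⟨t, s, ht0, ht1, hs0, hhi, hlo⟩ : ∃ t s : ℝ, 0 < t ∧ t < 1 ∧ 0 ≤ s ∧
      (∀ i < p, s ≤ sv B i) ∧ ∀ i, p ≤ i → sv B i / t ≤ s := by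
    rcases Nat.eq_zero_or_pos p with rfl | hp
    · refine ⟨1 / 2, sv B 0 / (1 / 2), by norm_num, by norm_num,
        div_nonneg (sv_nonneg B 0) (by norm_num), by simp, fun i _ => ?_⟩
      have := sv_antitone B (Nat.zero_le i)
      gcongr
    · have hg := hgap hp
      have h0 := sv_nonneg B p
      have hpos : 0 < sv B (p - 1) := h0.trans_lt hg
      refine ⟨(sv B p + sv B (p - 1)) / (2 * sv B (p - 1)), sv B (p - 1), by positivity, ?_,
        hpos.le, fun i hi => sv_antitone B (by omega), fun i hi => ?_⟩
      · rw [div_lt_one (by positivity)]; linarith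
      · have := sv_antitone B hi
        rw [div_le_iff₀ (by positivity)]
        field_simp
        linarith
  -- Past the width all singular values vanish, so there is no room for a gap.
  have hpn : p ≤ n := by
    by_contra h
    have h1 := hgap (by omega)
    rw [sv_eq_zero_of_width_le B (i := p - 1) (by omega)] at h1
    exact absurd (sv_nonneg B p) (not_le.2 h1)
  refine ⟨1 - t, by linarith, by linarith, fun H₀ hH₀ H hH => ?_⟩
  obtain ⟨U, hU, V, hV, hB, hH₀⟩ := hH₀
  set d : ℕ → ℝ := fun i => if i < p then sv B i else sv B i / t with hd
  have hd_trunc : (fun i => if i < p then d i else 0) = fun i => if i < p then sv B i else 0 := by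
    funext i
    by_cases h : i < p <;> simp [hd, h]
  have hM : U * rectDiag m n d * Vᵀ - H₀ = t⁻¹ • (B - H₀) := by
    conv_rhs => rw [hB]
    rw [hH₀, ← Matrix.sub_mul, ← Matrix.mul_sub, ← Matrix.sub_mul, ← Matrix.mul_sub, rectDiag_sub,
      rectDiag_sub, ← Matrix.smul_mul, ← Matrix.mul_smul]
    congr 2
    ext i j
    by_cases h : (i : ℕ) = j <;> by_cases h' : (j : ℕ) < p <;>
      simp [rectDiag, hd, h, h', div_eq_inv_mul]
  have hey := eckart_young hpn hs0 (d := d)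
    (fun i => by simp only [hd]; split_ifs <;> [skip; apply div_nonneg _ ht0.le] <;>
      exact sv_nonneg B i)
    (fun i hi => by simpa [hd, hi] using hhi i hi)
    (fun i hi => by simpa [hd, not_lt.2 hi] using hlo i hi) hU hV hH
  have hMH : U * rectDiag m n d * Vᵀ - H = t⁻¹ • (B - H₀) - (H - H₀) := by rw [← hM]; abel
  have hBH : B - H = (B - H₀) - (H - H₀) := by abel
  rw [hd_trunc, ← hH₀, hM, hMH, frobenius_norm_sub_sq (t⁻¹ • (B - H₀)), transpose_smul,
    Matrix.smul_mul, trace_smul, smul_eq_mul] at hey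
  rw [hBH, frobenius_norm_sub_sq (B - H₀)]
  -- Optimality of `H₀` for the enlarged matrix bounds twice the inner product of `B - H₀` and `H -
  -- H₀` by `t‖H - H₀‖²`; expanding `‖B - H‖²` leaves the factor `1 - t`.
  have h1 : 2 * (t⁻¹ * trace ((B - H₀)ᵀ * (H - H₀))) ≤ ‖H - H₀‖ ^ 2 := by linarith
  have h2 : t * (2 * (t⁻¹ * trace ((B - H₀)ᵀ * (H - H₀)))) ≤ t * ‖H - H₀‖ ^ 2 := by gcongr
  have h3 : t * (2 * (t⁻¹ * trace ((B - H₀)ᵀ * (H - H₀)))) =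
      2 * trace ((B - H₀)ᵀ * (H - H₀)) := by field_simp
  linarith

/-! ### The constrained problem -/

lemma range_mulVecLin_fromCols {m k l : ℕ} (A : Matrix (Fin m) (Fin k) ℝ)
    (X : Matrix (Fin m) (Fin l) ℝ) :
    LinearMap.range (fromCols A X).mulVecLin =
      LinearMap.range A.mulVecLin ⊔ LinearMap.range X.mulVecLin := by
  apply le_antisymm
  · rintro _ ⟨v, rfl⟩
    rw [mulVecLin_apply, fromCols_mulVec]
    exact Submodule.add_mem_sup ⟨_, rfl⟩ ⟨_, rfl⟩
  · rw [sup_le_iff]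
    constructor
    · rintro _ ⟨v, rfl⟩
      exact ⟨Sum.elim v 0, by simp [fromCols_mulVec]⟩
    · rintro _ ⟨v, rfl⟩
      exact ⟨Sum.elim 0 v, by simp [fromCols_mulVec]⟩

/-- The rank of `(A X)` is the rank of `A` plus that of the part of `X` orthogonal to the column
space of `A`. -/
lemma rank_fromCols {m k l : ℕ} (A : Matrix (Fin m) (Fin k) ℝ) (X : Matrix (Fin m) (Fin l) ℝ) :
    (fromCols A X).rank = A.rank + ((1 - projMat A) * X).rank := by
  obtain ⟨Z, hZ⟩ := exists_projMat_eq_mul A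
  have hX (v : Fin l → ℝ) : X *ᵥ v = A *ᵥ (Z *ᵥ X *ᵥ v) + ((1 - projMat A) * X) *ᵥ v := by
    rw [hZ, mulVec_mulVec, mulVec_mulVec, ← add_mulVec]
    rw [Matrix.sub_mul, Matrix.one_mul, add_sub_cancel]
  -- As `projMat A = A * Z`, the columns of `X` and `(1 - projMat A) * X` differ by elements of the
  -- column space of `A`.
  have hsup : LinearMap.range A.mulVecLin ⊔ LinearMap.range X.mulVecLin =
      LinearMap.range A.mulVecLin ⊔ LinearMap.range ((1 - projMat A) * X).mulVecLin := by
    apply le_antisymm <;> refine sup_le le_sup_left ?_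
    · rintro _ ⟨v, rfl⟩
      rw [mulVecLin_apply, hX]
      exact Submodule.add_mem_sup ⟨_, rfl⟩ ⟨_, rfl⟩
    · rintro _ ⟨v, rfl⟩
      have h : ((1 - projMat A) * X) *ᵥ v = A *ᵥ (-(Z *ᵥ X *ᵥ v)) + X *ᵥ v := by
        rw [mulVec_neg, eq_neg_add_iff_add_eq, ← hX]
      rw [mulVecLin_apply, h]
      exact Submodule.add_mem_sup ⟨_, rfl⟩ ⟨_, rfl⟩
  have hinf : LinearMap.range A.mulVecLin ⊓ LinearMap.range ((1 - projMat A) * X).mulVecLin =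
      ⊥ := by
    rw [Submodule.eq_bot_iff]
    rintro _ ⟨⟨v, rfl⟩, ⟨w, hw⟩⟩
    rw [mulVecLin_apply, mulVecLin_apply] at hw
    have h1 : projMat A *ᵥ (A *ᵥ v) = A *ᵥ v := by rw [mulVec_mulVec, projMat_mul_self]
    rw [mulVecLin_apply, ← h1, ← hw, mulVec_mulVec, ← Matrix.mul_assoc, Matrix.mul_sub,
      projMat_mul_projMat]
    simp
  have h := Submodule.finrank_sup_add_finrank_inf_eq (LinearMap.range A.mulVecLin)
    (LinearMap.range ((1 - projMat A) * X).mulVecLin)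
  rw [hinf, finrank_bot, add_zero, ← hsup, ← range_mulVecLin_fromCols] at h
  exact h

lemma frobenius_norm_sq_eq_projMat_add {m n l : ℕ} (A : Matrix (Fin m) (Fin n) ℝ)
    (M : Matrix (Fin m) (Fin l) ℝ) :
    ‖M‖ ^ 2 = ‖projMat A * M‖ ^ 2 + ‖(1 - projMat A) * M‖ ^ 2 := by
  have h : M = projMat A * M + (1 - projMat A) * M := by
    rw [Matrix.sub_mul, Matrix.one_mul, add_sub_cancel]
  have h0 : (projMat A * M)ᵀ * ((1 - projMat A) * M) = 0 := by
    rw [transpose_mul, projMat_transpose, Matrix.mul_assoc, ← Matrix.mul_assoc (projMat A),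
      Matrix.mul_sub, projMat_mul_projMat]
    simp
  conv_lhs => rw [h]
  rw [frobenius_norm_add_sq, h0]
  simp

/-- A best approximation of a matrix orthogonal to the column space of `A` is orthogonal to it. -/
lemma projMat_mul_eq_zero_of_forall_le {m k l p : ℕ} (A : Matrix (Fin m) (Fin k) ℝ)
    (X H : Matrix (Fin m) (Fin l) ℝ) (hH : H.rank ≤ p)
    (hmin : ∀ H' : Matrix (Fin m) (Fin l) ℝ, H'.rank ≤ p →
      ‖(1 - projMat A) * X - H‖ ^ 2 ≤ ‖(1 - projMat A) * X - H'‖ ^ 2) :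
    projMat A * H = 0 := by
  -- Dropping `projMat A * H` from `H` does not raise the rank and lowers the squared residual by
  -- exactly `‖projMat A * H‖²`.
  have h := hmin ((1 - projMat A) * H) ((rank_mul_le_right _ _).trans hH)
  have hP : projMat A * (1 - projMat A) = 0 := by
    rw [Matrix.mul_sub, projMat_mul_projMat, Matrix.mul_one, sub_self]
  have hP' : (1 - projMat A) * (1 - projMat A) = 1 - projMat A := by
    rw [Matrix.sub_mul, hP, Matrix.one_mul, sub_zero]
  rw [frobenius_norm_sq_eq_projMat_add A, Matrix.mul_sub, Matrix.mul_sub, ← Matrix.mul_assoc, hP,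
    ← Matrix.mul_assoc, hP', Matrix.zero_mul, zero_sub, norm_neg] at h
  have h0 : ‖projMat A * H‖ = 0 := by
    have : ‖projMat A * H‖ ^ 2 = 0 := le_antisymm (by linarith) (sq_nonneg _)
    simpa using this
  exact norm_eq_zero.1 h0

/-- Quadratic growth for the constrained low rank approximation problem. -/
lemma constrained_quadratic_growth {m k l p : ℕ} (A₁ : Matrix (Fin m) (Fin k) ℝ)
    (A₂ H : Matrix (Fin m) (Fin l) ℝ) {c : ℝ} (hc : 0 ≤ c) (hc1 : c ≤ 1) (hH : H.rank ≤ p)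
    (hgrowth : ∀ H' : Matrix (Fin m) (Fin l) ℝ, H'.rank ≤ p →
      ‖(1 - projMat A₁) * A₂ - H‖ ^ 2 + c * ‖H' - H‖ ^ 2 ≤ ‖(1 - projMat A₁) * A₂ - H'‖ ^ 2)
    {X : Matrix (Fin m) (Fin l) ℝ} (hX : (fromCols A₁ X).rank ≤ A₁.rank + p) :
    ‖A₂ - (projMat A₁ * A₂ + H)‖ ^ 2 + c * ‖X - (projMat A₁ * A₂ + H)‖ ^ 2 ≤ ‖A₂ - X‖ ^ 2 := by
  have hPH := projMat_mul_eq_zero_of_forall_le A₁ A₂ H hH fun H' hH' =>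
    (le_add_of_nonneg_right (by positivity)).trans (hgrowth H' hH')
  rw [rank_fromCols] at hX
  have hg := hgrowth ((1 - projMat A₁) * X) (by omega)
  have h1 : A₂ - (projMat A₁ * A₂ + H) = (1 - projMat A₁) * A₂ - H := by
    rw [Matrix.sub_mul, Matrix.one_mul]; abel
  have h2 : projMat A₁ * (X - (projMat A₁ * A₂ + H)) = -(projMat A₁ * (A₂ - X)) := by
    rw [Matrix.mul_sub, Matrix.mul_add, ← Matrix.mul_assoc, projMat_mul_projMat, hPH,
      Matrix.mul_sub]
    abel
  have h3 : (1 - projMat A₁) * (X - (projMat A₁ * A₂ + H)) = (1 - projMat A₁) * X - H := by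
    rw [Matrix.mul_sub, Matrix.mul_add, ← Matrix.mul_assoc, Matrix.sub_mul 1 _ (projMat A₁),
      projMat_mul_projMat, Matrix.sub_mul 1 _ H, hPH]
    simp
  rw [h1, frobenius_norm_sq_eq_projMat_add A₁ (X - _), h2, h3, norm_neg,
    frobenius_norm_sq_eq_projMat_add A₁ (A₂ - X), Matrix.mul_sub (1 - projMat A₁)]
  -- The component in the column space of `A₁` appears with coefficient `c` on the left and `1` on
  -- the right, hence the need for `c ≤ 1`.
  nlinarith [sq_nonneg ‖projMat A₁ * (A₂ - X)‖]

/-- A growth condition at `A'` turns a multiplicative perturbation `1 + E` of the constraint into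
a perturbation of the solution of at most linear size. -/
lemma norm_sub_le_of_quadratic_growth {m l : ℕ} (A₂ A' Y : Matrix (Fin m) (Fin l) ℝ)
    (E : Matrix (Fin m) (Fin m) ℝ) (hE : ‖E‖ ≤ 1 / 2) {c : ℝ} (hc : 0 < c)
    (hgrowth : ‖A₂ - A'‖ ^ 2 + c * ‖Y - A'‖ ^ 2 ≤ ‖A₂ - Y‖ ^ 2)
    (hmin : ‖A₂ - (1 + E) * Y‖ ^ 2 ≤ ‖A₂ - (1 + E) * A'‖ ^ 2) :
    ‖(1 + E) * Y - A'‖ ≤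
      ((4 * ‖A₂‖ + 9 * ‖A'‖) / c + (4 * ‖A₂‖ + 3 * ‖A'‖)) * ‖E‖ := by
  set D := Y - A' with hD
  set S := A₂ - (1 + E) * Y with hS
  set S' := A₂ - (1 + E) * A' with hS'
  have hE0 := norm_nonneg E
  have ha := norm_nonneg A₂
  have hb := norm_nonneg A'
  have hδ := norm_nonneg D
  have hEA : ‖E * A'‖ ≤ ‖E‖ * ‖A'‖ := frobenius_norm_mul _ _
  have hED : ‖E * D‖ ≤ ‖E‖ * ‖D‖ := frobenius_norm_mul _ _
  have hEY : ‖E * Y‖ ≤ ‖E‖ * ‖Y‖ := frobenius_norm_mul _ _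
  have hSS' : ‖S‖ ≤ ‖S'‖ := le_of_sq_le_sq hmin (norm_nonneg _)
  have hS'b : ‖S'‖ ≤ ‖A₂‖ + 3 / 2 * ‖A'‖ := by
    have h : S' = A₂ - (A' + E * A') := by rw [hS', Matrix.add_mul, Matrix.one_mul]
    have h1 : ‖S'‖ ≤ ‖A₂‖ + (‖A'‖ + ‖E * A'‖) := by
      rw [h]; exact (norm_sub_le _ _).trans (by gcongr; exact norm_add_le _ _)
    nlinarith
  -- `‖E‖ ≤ 1/2` allows the term `E * Y` to be absorbed.
  have hYb : ‖Y‖ ≤ 4 * ‖A₂‖ + 3 * ‖A'‖ := by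
    have h : Y = A₂ - S - E * Y := by rw [hS, Matrix.add_mul, Matrix.one_mul]; abel
    have h1 : ‖Y‖ ≤ ‖A₂‖ + ‖S‖ + ‖E * Y‖ := by
      conv_lhs => rw [h]
      exact (norm_sub_le _ _).trans (by gcongr; exact norm_sub_le _ _)
    nlinarith [norm_nonneg Y]
  have hDb : ‖D‖ ≤ ‖Y‖ + ‖A'‖ := norm_sub_le _ _
  have e1 : A₂ - Y = S + E * Y := by rw [hS, Matrix.add_mul, Matrix.one_mul]; abel
  have e2 : A₂ - A' = S' + E * A' := by rw [hS', Matrix.add_mul, Matrix.one_mul]; abel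
  have e3 : E * Y = E * A' + E * D := by rw [hD, ← Matrix.mul_add, add_sub_cancel]
  have e4 : S = S' - (D + E * D) := by
    rw [hS, hS', hD, Matrix.add_mul, Matrix.add_mul, Matrix.mul_sub, Matrix.one_mul,
      Matrix.one_mul]
    abel
  have e5 : trace (Sᵀ * (E * A')) = trace (S'ᵀ * (E * A')) - trace ((D + E * D)ᵀ * (E * A')) := by
    rw [e4, transpose_sub, Matrix.sub_mul, trace_sub]
  -- The terms of order `‖E‖` without a factor `D` cancel between the two sides, and `‖S‖² ≤ ‖S'‖²`
  -- disposes of the main terms. Everything left is `O(‖E‖ ‖D‖)`; `j1` to `j4` add up to the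
  -- constant `4‖A₂‖ + 9‖A'‖`.
  rw [e1, e2, frobenius_norm_add_sq, frobenius_norm_add_sq S, e3, Matrix.mul_add, trace_add, e5,
    frobenius_norm_add_sq (E * A')] at hgrowth
  have i1 := (abs_le.1 (abs_trace_transpose_mul_le S (E * D))).2
  have i2 := (abs_le.1 (abs_trace_transpose_mul_le (D + E * D) (E * A'))).1
  have i3 := (abs_le.1 (abs_trace_transpose_mul_le (E * A') (E * D))).2
  have j1 : ‖S‖ * ‖E * D‖ ≤ (‖A₂‖ + 3 / 2 * ‖A'‖) * (‖E‖ * ‖D‖) := by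
    exact mul_le_mul (hSS'.trans hS'b) hED (norm_nonneg _) (by positivity)
  have j2 : ‖D + E * D‖ * ‖E * A'‖ ≤ 3 / 2 * ‖D‖ * (‖E‖ * ‖A'‖) := by
    have h : ‖D + E * D‖ ≤ 3 / 2 * ‖D‖ := (norm_add_le _ _).trans (by nlinarith)
    exact mul_le_mul h hEA (norm_nonneg _) (by positivity)
  have j3 : ‖E * A'‖ * ‖E * D‖ ≤ (1 / 2 * ‖A'‖) * (‖E‖ * ‖D‖) := by
    exact mul_le_mul (hEA.trans (mul_le_mul_of_nonneg_right hE hb)) hED (norm_nonneg _)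
      (by positivity)
  have j4 : ‖E * D‖ ^ 2 ≤ (1 / 2 * (4 * ‖A₂‖ + 4 * ‖A'‖)) * (‖E‖ * ‖D‖) := by
    have hD4 : ‖D‖ ≤ 4 * ‖A₂‖ + 4 * ‖A'‖ := by linarith
    rw [sq]
    exact mul_le_mul (hED.trans (mul_le_mul hE hD4 hδ (by norm_num))) hED (norm_nonneg _)
      (by positivity)
  have key : c * ‖D‖ * ‖D‖ ≤ (4 * ‖A₂‖ + 9 * ‖A'‖) * ‖E‖ * ‖D‖ := by linarith
  have hDE : ‖D‖ ≤ (4 * ‖A₂‖ + 9 * ‖A'‖) / c * ‖E‖ := by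
    rcases hδ.eq_or_lt with h | h
    · rw [← h]; positivity
    · have := le_of_mul_le_mul_right key h
      rw [div_mul_eq_mul_div, le_div_iff₀ hc]
      linarith
  have hfin : (1 + E) * Y - A' = D + E * Y := by
    rw [hD, Matrix.add_mul, Matrix.one_mul]; abel
  rw [hfin, add_mul]
  refine (norm_add_le _ _).trans (add_le_add hDE (hEY.trans ?_))
  rw [mul_comm]
  gcongr

/-! ### Weights -/

lemma minWeight_le {m k : ℕ} (W : Matrix (Fin m) (Fin k) ℝ) (i : Fin m) (j : Fin k) :
    minWeight W ≤ W i j :=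
  (ciInf_le (Set.finite_range _).bddBelow j).trans (ciInf_le (Set.finite_range _).bddBelow i)

lemma mul_norm_le_norm_hadamard {m k : ℕ} {W : Matrix (Fin m) (Fin k) ℝ} {c : ℝ} (hc : 0 ≤ c)
    (hW : ∀ i j, c ≤ W i j) (M : Matrix (Fin m) (Fin k) ℝ) : c * ‖M‖ ≤ ‖M ⊙ W‖ := by
  refine le_of_sq_le_sq ?_ (norm_nonneg _)
  rw [mul_pow, frobenius_norm_sq_eq_sum, frobenius_norm_sq_eq_sum, Finset.mul_sum]
  refine Finset.sum_le_sum fun i _ => ?_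
  rw [Finset.mul_sum]
  refine Finset.sum_le_sum fun j _ => ?_
  have := hW i j
  rw [hadamard_apply, mul_pow, mul_comm]
  gcongr

lemma norm_weighted_residual_sq {m k l : ℕ} (A₁ X₁ W₁ : Matrix (Fin m) (Fin k) ℝ)
    (A₂ X₂ : Matrix (Fin m) (Fin l) ℝ) :
    ‖(fromCols A₁ A₂ - fromCols X₁ X₂) ⊙ fromCols W₁ (of fun _ _ => 1)‖ ^ 2 =
      ‖(A₁ - X₁) ⊙ W₁‖ ^ 2 + ‖A₂ - X₂‖ ^ 2 := by
  rw [← frobenius_norm_fromCols_sq]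
  congr 2
  ext i (j | j) <;> simp

lemma exists_left_inverse_of_rank_eq {m k : ℕ} {A : Matrix (Fin m) (Fin k) ℝ} (hA : A.rank = k) :
    ∃ Z : Matrix (Fin k) (Fin m) ℝ, Z * A = 1 := by
  have h : Function.Surjective Aᵀ.mulVec := by
    have h1 : LinearMap.range Aᵀ.mulVecLin = ⊤ := by
      apply Submodule.eq_top_of_finrank_eq
      rw [← rank, rank_transpose, hA]
      simp
    exact LinearMap.range_eq_top.1 h1
  obtain ⟨Z, hZ⟩ := mulVec_surjective_iff_exists_right_inverse.1 h
  exact ⟨Zᵀ, by rw [← transpose_transpose A, ← transpose_mul, hZ, transpose_one]⟩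

/-- Neumann series: the Frobenius norm is submultiplicative and the space is complete. -/
lemma isUnit_one_add_of_norm_lt_one {m : ℕ} {E : Matrix (Fin m) (Fin m) ℝ} (hE : ‖E‖ < 1) :
    IsUnit (1 + E) := by
  let _ : NormedRing (Matrix (Fin m) (Fin m) ℝ) := frobeniusNormedRing
  have : CompleteSpace (Matrix (Fin m) (Fin m) ℝ) := FiniteDimensional.complete ℝ _
  have h := isUnit_one_sub_of_norm_lt_one (x := -E) (by rwa [norm_neg])
  rwa [sub_neg_eq_add] at h

end WLRA

end

/- The first conjunct says that the constrained problem has exactly one solution `(A₁ A₂')`, the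
second that `A₂'` is `P_{A₁}(A₂) + H_{r-k}(P_{A₁}^⊥(A₂))` (in particular the thresholding exists and
is unique), the third is the rate, uniform over all weights and over all solutions. For `r = k`
there is no gap to assume (the zeroth singular value counts as infinite). -/
theorem theorem2p1 (m k l r : ℕ) (hk : 0 < k)
    (A₁ : Matrix (Fin m) (Fin k) ℝ) (A₂ : Matrix (Fin m) (Fin l) ℝ)
    (hA₁ : A₁.rank = k) (hkr : k ≤ r)
    (hgap : k < r →
      WLRA.sv (WLRA.projPerp A₁ A₂) (r - k) < WLRA.sv (WLRA.projPerp A₁ A₂) (r - k - 1)) :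
    ∃ A₂' : Matrix (Fin m) (Fin l) ℝ,
      (∀ (X₁ : Matrix (Fin m) (Fin k) ℝ) (X₂ : Matrix (Fin m) (Fin l) ℝ),
        WLRA.IsConstrainedSolution A₁ A₂ r X₁ X₂ ↔ X₁ = A₁ ∧ X₂ = A₂') ∧
      (∀ H : Matrix (Fin m) (Fin l) ℝ,
        WLRA.IsHardThresholding (r - k) (WLRA.projPerp A₁ A₂) H ↔
          A₂' = WLRA.proj A₁ A₂ + H) ∧
      ∃ C Λ : ℝ, 0 < Λ ∧
        ∀ W₁ : Matrix (Fin m) (Fin k) ℝ, Λ ≤ WLRA.minWeight W₁ →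
          ∀ (X₁ : Matrix (Fin m) (Fin k) ℝ) (X₂ : Matrix (Fin m) (Fin l) ℝ),
            WLRA.IsWeightedSolution A₁ A₂ W₁ (Matrix.of fun _ _ => 1) r X₁ X₂ →
              ‖Matrix.fromCols X₁ X₂ - Matrix.fromCols A₁ A₂'‖ ≤ C / WLRA.minWeight W₁ := by
  obtain ⟨H, hH⟩ := WLRA.exists_isHardThresholding (r - k) (WLRA.projPerp A₁ A₂)
  obtain ⟨c, hc0, hc1, hgrowth⟩ :=
    WLRA.exists_quadratic_growth (p := r - k) (WLRA.projPerp A₁ A₂) (fun h => hgap (by omega))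
  set A' := WLRA.proj A₁ A₂ + H with hA'
  have hfeasible : (Matrix.fromCols A₁ A').rank ≤ r := by
    have hPH : WLRA.projMat A₁ * H = 0 :=
      WLRA.projMat_mul_eq_zero_of_forall_le A₁ A₂ H hH.rank_le fun H' hH' => by
        rw [← WLRA.projPerp_eq_mul]
        exact (le_add_of_nonneg_right (by positivity)).trans (hgrowth H hH H' hH')
    have h : (1 - WLRA.projMat A₁) * A' = H := by
      rw [hA', WLRA.proj_eq_mul, Matrix.mul_add, ← Matrix.mul_assoc, Matrix.sub_mul,
        WLRA.projMat_mul_projMat, Matrix.sub_mul 1 _ H, hPH]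
      simp
    have h1 := hH.rank_le
    rw [WLRA.rank_fromCols, h, hA₁]
    omega
  have hconstrained (X : Matrix (Fin m) (Fin l) ℝ) (hX : (Matrix.fromCols A₁ X).rank ≤ r) :
      ‖A₂ - A'‖ ^ 2 + c * ‖X - A'‖ ^ 2 ≤ ‖A₂ - X‖ ^ 2 := by
    rw [hA', WLRA.proj_eq_mul]
    refine WLRA.constrained_quadratic_growth (p := r - k) A₁ A₂ H hc0.le hc1 hH.rank_le
      (fun H' hH' => ?_) (by rw [hA₁]; omega)
    rw [← WLRA.projPerp_eq_mul]
    exact hgrowth H hH H' hH'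
  have hnorm (X : Matrix (Fin m) (Fin l) ℝ) :
      ‖Matrix.fromCols A₁ A₂ - Matrix.fromCols A₁ X‖ ^ 2 = ‖A₂ - X‖ ^ 2 := by
    rw [WLRA.fromCols_sub_fromCols, WLRA.frobenius_norm_fromCols_sq]
    simp
  refine ⟨A', fun X₁ X₂ => ⟨?_, ?_⟩, fun H' => ⟨fun hH' => ?_, fun h => ?_⟩, ?_⟩
  · rintro ⟨rfl, hX, hmin⟩
    have h1 := hmin _ A' rfl hfeasible
    rw [hnorm, hnorm] at h1
    have h2 := hconstrained X₂ hX
    have h3 : ‖X₂ - A'‖ ^ 2 = 0 := le_antisymm (by nlinarith) (sq_nonneg _)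
    exact ⟨rfl, sub_eq_zero.1 (norm_eq_zero.1 (pow_eq_zero_iff two_ne_zero |>.1 h3))⟩
  · rintro ⟨rfl, rfl⟩
    refine ⟨rfl, hfeasible, ?_⟩
    rintro _ Y rfl hY
    rw [hnorm, hnorm]
    exact (le_add_of_nonneg_right (by positivity)).trans (hconstrained Y hY)
  -- Growth around either of two thresholdings, applied to the other, forces them to coincide.
  · have h1 := hgrowth H hH H' hH'.rank_le
    have h2 := hgrowth H' hH' H hH.rank_le
    have h3 : ‖H' - H‖ ^ 2 = 0 := by
      have := mul_nonneg hc0.le (sq_nonneg ‖H - H'‖)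
      exact le_antisymm (by nlinarith) (sq_nonneg _)
    rw [hA', sub_eq_zero.1 (norm_eq_zero.1 (pow_eq_zero_iff two_ne_zero |>.1 h3))]
  · rwa [← add_left_cancel (hA'.symm.trans h)]
  · obtain ⟨Z, hZ⟩ := WLRA.exists_left_inverse_of_rank_eq hA₁
    set K := (4 * ‖A₂‖ + 9 * ‖A'‖) / c + (4 * ‖A₂‖ + 3 * ‖A'‖) with hK
    -- The entry `1` keeps the weight positive; the other entry makes `‖E‖ ≤ 1/2`.
    refine ⟨‖A₂ - A'‖ + K * (‖A₂ - A'‖ * ‖Z‖), max 1 (2 * (‖A₂ - A'‖ * ‖Z‖)),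
      lt_max_of_lt_left one_pos, ?_⟩
    rintro W₁ hW X₁ X₂ ⟨hrank, hmin⟩
    set w := WLRA.minWeight W₁ with hw
    have hw0 : 0 < w := one_pos.trans_le ((le_max_left _ _).trans hW)
    have hX₁ : ‖X₁ - A₁‖ ≤ ‖A₂ - A'‖ / w := by
      have h1 := hmin A₁ A' hfeasible
      rw [WLRA.norm_weighted_residual_sq, WLRA.norm_weighted_residual_sq, sub_self,
        Matrix.zero_hadamard, norm_zero] at h1
      have h2 : ‖(A₁ - X₁) ⊙ W₁‖ ≤ ‖A₂ - A'‖ :=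
        le_of_sq_le_sq (by nlinarith [sq_nonneg ‖A₂ - X₂‖]) (norm_nonneg _)
      have h3 := WLRA.mul_norm_le_norm_hadamard hw0.le (WLRA.minWeight_le W₁) (A₁ - X₁)
      rw [le_div_iff₀ hw0, norm_sub_rev, mul_comm]
      exact h3.trans h2
    set E := (X₁ - A₁) * Z with hE
    have hEA : (1 + E) * A₁ = X₁ := by
      rw [Matrix.add_mul, hE, Matrix.mul_assoc, hZ, Matrix.one_mul, Matrix.mul_one,
        add_sub_cancel]
    have hEn : ‖E‖ ≤ ‖A₂ - A'‖ * ‖Z‖ / w := by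
      rw [← div_mul_eq_mul_div]
      exact (Matrix.frobenius_norm_mul _ _).trans (by gcongr)
    have hE2 : ‖E‖ ≤ 1 / 2 := by
      refine hEn.trans ?_
      rw [div_le_iff₀ hw0]
      have := (le_max_right _ _).trans hW
      linarith
    have hunit : IsUnit (1 + E) :=
      WLRA.isUnit_one_add_of_norm_lt_one (hE2.trans_lt (by norm_num))
    obtain ⟨Y, hY⟩ : ∃ Y : Matrix (Fin m) (Fin l) ℝ, (1 + E) * Y = X₂ := by
      refine ⟨(1 + E)⁻¹ * X₂, ?_⟩
      rw [← Matrix.mul_assoc, Matrix.mul_nonsing_inv _ ((Matrix.isUnit_iff_isUnit_det _).1 hunit),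
        Matrix.one_mul]
    have hYrank : (Matrix.fromCols A₁ Y).rank ≤ r := by
      rwa [← Matrix.rank_mul_eq_right_of_isUnit_det (1 + E) _
        ((Matrix.isUnit_iff_isUnit_det _).1 hunit), Matrix.mul_fromCols, hEA, hY]
    -- The competitor has the same first block `X₁`, so the weighted terms cancel.
    have hcomp : ‖A₂ - (1 + E) * Y‖ ^ 2 ≤ ‖A₂ - (1 + E) * A'‖ ^ 2 := by
      have h1 := hmin X₁ ((1 + E) * A') (by
        rw [← hEA, ← Matrix.mul_fromCols]
        exact (Matrix.rank_mul_le_right _ _).trans hfeasible)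
      rw [WLRA.norm_weighted_residual_sq, WLRA.norm_weighted_residual_sq] at h1
      rw [hY]
      linarith
    have hX₂ := WLRA.norm_sub_le_of_quadratic_growth A₂ A' Y E hE2 hc0 (hconstrained Y hYrank) hcomp
    rw [hY, ← hK] at hX₂
    have hK0 : 0 ≤ K := by positivity
    have hsplit : ‖Matrix.fromCols X₁ X₂ - Matrix.fromCols A₁ A'‖ ≤ ‖X₁ - A₁‖ + ‖X₂ - A'‖ := by
      refine le_of_sq_le_sq ?_ (by positivity)
      rw [WLRA.fromCols_sub_fromCols, WLRA.frobenius_norm_fromCols_sq]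
      nlinarith [mul_nonneg (norm_nonneg (X₁ - A₁)) (norm_nonneg (X₂ - A'))]
    rw [add_div, mul_div_assoc]
    refine hsplit.trans (add_le_add hX₁ (hX₂.trans ?_))
    gcongr
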